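/- Let $d,n\ge 1$ be integers and $0<B\le 1$. Let $W^{n,\infty}([-B,B]^d)$ be the space of all $f\in L^\infty([-B,B]^d)$ whose weak derivatives $D^{\boldsymbol\alpha}f$ exist and lie in $L^\infty([-B,B]^d)$ for all multi-indices $\boldsymbol\alpha\in\mathbb N^d$ with $|\boldsymbol\alpha|\le n$, with the norm $\|f\|_{W^{n,\infty}}=\max_{|\boldsymbol\alpha|\le n}\operatorname{ess\,sup}_{[-B,B]^d}|D^{\boldsymbol\alpha}f|$, and let $\mathcal F_{n,d}=\{f\in W^{n,\infty}([-B,B]^d):\|f\|_{W^{n,\infty}}\le 1\}$. A SiLU network is a finite composition of affine maps $x\mapsto Wx+b$, each of which except the last is followed by the componentwise application of $\mathrm{SiLU}(t)=t/(1+e^{-t})$. Its depth is the number of its affine maps, and its size is the number of its neurons (the output included) plus the number of its nonzero weights and biases. There are constants $L\in\mathbb N$ and $C>0$, depending only on $d$, $n$ and $B$, such that the following holds. Every $f\in\mathcal F_{n,d}$ has a continuous representative on $[-B,B]^d$, again denoted by $f$, and for every $\varepsilon\in(0,1)$ there is a SiLU network $\widetilde f_\varepsilon:\mathbb R^d\to\mathbb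 R$ with $$\sup_{\mathbf x\in[-B,B]^d}|f(\mathbf x)-\widetilde f_\varepsilon(\mathbf x)|\le\varepsilon,\qquad \operatorname{size}(\widetilde f_\varepsilon)\le C\,\varepsilon^{-d/n},\qquad \operatorname{depth}(\widetilde f_\varepsilon)=L.$$ -/

import Mathlib

open MeasureTheory
open scoped ENNReal ContDiff

noncomputable section

/-- The SiLU activation `x ↦ x / (1 + e^{-x})`. -/
def silu (x : ℝ) : ℝ := x / (1 + Real.exp (-x))

/-- `SiLUNet q p`: feedforward SiLU networks with `q` outputs and `p` inputs, a chain of affine maps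
`x ↦ W x + b`, each one except the last followed by SiLU applied componentwise. -/
inductive SiLUNet (q : ℕ) : ℕ → Type
  /-- The affine output layer. -/
  | output {p : ℕ} (W : Matrix (Fin q) (Fin p) ℝ) (b : Fin q → ℝ) : SiLUNet q p
  /-- A hidden layer with `k` neurons, followed by the rest of the network. -/
  | hidden {p k : ℕ} (W : Matrix (Fin k) (Fin p) ℝ) (b : Fin k → ℝ) (N : SiLUNet q k) :
      SiLUNet q p

namespace SiLUNet

/-- The function `ℝ^p → ℝ^q` that the network computes. -/
def eval {q : ℕ} : {p : ℕ} → SiLUNet q p → (Fin p → ℝ) → (Fin q → ℝ)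
  | _, output W b, x => W.mulVec x + b
  | _, hidden W b N, x => N.eval (fun i => silu ((W.mulVec x + b) i))

/-- The number of layers, that is, of affine maps (hidden layers and the output layer). -/
def depth {q : ℕ} : {p : ℕ} → SiLUNet q p → ℕ
  | _, output _ _ => 1
  | _, hidden _ _ N => N.depth + 1

/-- The number of parameters of an affine layer: nonzero weights (connections) and nonzero
biases. -/
def layerParams {p k : ℕ} (W : Matrix (Fin k) (Fin p) ℝ) (b : Fin k → ℝ) : ℕ :=
  Set.ncard {ij : Fin k × Fin p | W ij.1 ij.2 ≠ 0} + Set.ncard {i : Fin k | b i ≠ 0}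

/-- The size of a network: the number of its neurons plus the number of its parameters
(nonzero weights and biases), summed over all the layers. It bounds the number of parameters and
the number of neurons at once. -/
def size {q : ℕ} : {p : ℕ} → SiLUNet q p → ℕ
  | _, output W b => q + layerParams W b
  | _, @hidden _ _ k W b N => k + layerParams W b + N.size

end SiLUNet

/-- The closed cube `[-B, B]^d`. -/
def cube (d : ℕ) (B : ℝ) : Set (Fin d → ℝ) :=
  {x | ∀ i, x i ∈ Set.Icc (-B) B}

/-- The `i`-th partial derivative. -/
def partialDeriv {d : ℕ} (i : Fin d) (φ : (Fin d → ℝ) → ℝ) : (Fin d → ℝ) → ℝ :=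
  fun x => fderiv ℝ φ x (Pi.single i 1)

/-- The classical partial derivative `∂₁^{α₁} ⋯ ∂_d^{α_d} φ` of a smooth function. -/
def multiDeriv {d : ℕ} (α : Fin d → ℕ) (φ : (Fin d → ℝ) → ℝ) : (Fin d → ℝ) → ℝ :=
  (List.finRange d).foldr (fun i ψ => (partialDeriv i)^[α i] ψ) φ

/-- `g` is a weak derivative `D^α f` on the interior of `Ω`, tested against the smooth functions
with compact support in the interior of `Ω`. -/
def IsWeakDeriv {d : ℕ} (Ω : Set (Fin d → ℝ)) (α : Fin d → ℕ) (f g : (Fin d → ℝ) → ℝ) : Prop :=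
  LocallyIntegrableOn f (interior Ω) ∧ LocallyIntegrableOn g (interior Ω) ∧
    ∀ φ : (Fin d → ℝ) → ℝ, ContDiff ℝ ∞ φ → HasCompactSupport φ → tsupport φ ⊆ interior Ω →
      ∫ x in Ω, f x * multiDeriv α φ x = (-1) ^ (∑ i, α i) * ∫ x in Ω, g x * φ x

open Classical in
/-- The weak derivative `D^α f` (unique up to a null set where it exists; `0` if there is none). -/
def weakDeriv {d : ℕ} (Ω : Set (Fin d → ℝ)) (α : Fin d → ℕ) (f : (Fin d → ℝ) → ℝ) :
    (Fin d → ℝ) → ℝ :=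
  if h : ∃ g, IsWeakDeriv Ω α f g then h.choose else 0

/-- `f ∈ W^{n,∞}(Ω)`: `f ∈ L^∞(Ω)`, and all the weak derivatives `D^α f` with `|α| ≤ n` exist and
lie in `L^∞(Ω)`. -/
def MemSobolevInfty {d : ℕ} (n : ℕ) (Ω : Set (Fin d → ℝ)) (f : (Fin d → ℝ) → ℝ) : Prop :=
  MemLp f ∞ (volume.restrict Ω) ∧
    ∀ α : Fin d → ℕ, ∑ i, α i ≤ n →
      ∃ g, IsWeakDeriv Ω α f g ∧ MemLp g ∞ (volume.restrict Ω)

/-- `‖f‖_{W^{n,∞}(Ω)} = max_{|α| ≤ n} ess sup_Ω |D^α f|`. -/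
def sobolevInftyNorm {d : ℕ} (n : ℕ) (Ω : Set (Fin d → ℝ)) (f : (Fin d → ℝ) → ℝ) : ℝ≥0∞ :=
  ⨆ (α : Fin d → ℕ) (_ : ∑ i, α i ≤ n), eLpNorm (weakDeriv Ω α f) ∞ (volume.restrict Ω)

/-- The unit ball of `W^{n,∞}([-B, B]^d)`. -/
def sobolevBall (n d : ℕ) (B : ℝ) : Set ((Fin d → ℝ) → ℝ) :=
  {f | MemSobolevInfty n (cube d B) f ∧ sobolevInftyNorm n (cube d B) f ≤ 1}

end

/-! Place a grid with `N + 1` points per axis on the cube and blend the Taylor polynomials of degree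
less than `n` at its points with products of hat functions, which form a partition of unity. For a
smooth function whose derivatives are bounded by 1 the error is at most `(d * h) ^ n`, where `h = 2
* B / N`, so `N` of order `ε ^ (-1 / n)` suffices and there are about `ε ^ (-d / n)` grid points
(`exists_net_approx_smooth`).

Each term of the blend is a constant times a product of `d + n` factors, and each factor is a
combination of three rectified affine functions. Scaled SiLU neurons approximate the rectifiers. One
further hidden layer of fixed size approximates the product: a finite difference at a point where a
derivative of SiLU is nonzero gives a power, and polarization turns powers into products. The size
does not count the magnitude of the weights, so arbitrary accuracy costs no extra neurons. Hence
each grid point costs a constant, with no logarithmic factor, and the depth is 3.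

A Sobolev function is only weakly differentiable. Mollifying it and contracting the cube slightly
into its interior gives smooth functions with the same derivative bounds, uniformly close to a
Lipschitz representative (`exists_smooth_approx`). -/

/-! ### SiLU: comparison with the rectifier, and nonvanishing derivatives -/

theorem one_add_exp_neg_pos (x : ℝ) : 0 < 1 + Real.exp (-x) := by positivity

theorem contDiff_silu : ContDiff ℝ ∞ silu := by
  unfold silu
  exact contDiff_id.div (contDiff_const.add (Real.contDiff_exp.comp contDiff_neg))
    fun x => (one_add_exp_neg_pos x).ne'

theorem abs_silu_sub_max_le_one (t : ℝ) : |silu t - max t 0| ≤ 1 := by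
  have h := one_add_exp_neg_pos t
  have e := Real.exp_pos (-t)
  have hs : silu t * (1 + Real.exp (-t)) = t := div_mul_cancel₀ t h.ne'
  rcases le_total 0 t with ht | ht
  · rw [max_eq_left ht]
    have h1 : t * Real.exp (-t) ≤ 1 := by
      rw [Real.exp_neg, ← div_eq_mul_inv, div_le_one (Real.exp_pos t)]
      linarith [Real.add_one_le_exp t]
    rw [abs_le]
    constructor <;> nlinarith
  · rw [max_eq_right ht, sub_zero]
    have h1 := Real.add_one_le_exp (-t)
    rw [abs_le]
    constructor <;> nlinarith

/-- The rectifier is positively homogeneous, so dilation by `l` divides the bounded error by `l`: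
accuracy comes from large weights, not from more neurons. -/
theorem abs_silu_mul_div_sub_max_le {l : ℝ} (hl : 0 < l) (t : ℝ) :
    |silu (l * t) / l - max t 0| ≤ 1 / l := by
  have h : silu (l * t) / l - max t 0 = (silu (l * t) - max (l * t) 0) / l := by
    rw [show max (l * t) 0 = l * max t 0 by rw [mul_max_of_nonneg _ _ hl.le, mul_zero]]
    field_simp
  rw [h, abs_div, abs_of_pos hl]
  exact div_le_div_of_nonneg_right (abs_silu_sub_max_le_one _) hl.le

theorem tendsto_silu_neg_atTop : Filter.Tendsto (fun x => silu (-x)) Filter.atTop (nhds 0) := by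
  have h := (Real.tendsto_pow_mul_exp_neg_atTop_nhds_zero 1)
  refine squeeze_zero_norm' ?_ h
  filter_upwards [Filter.eventually_ge_atTop 0] with x hx
  rw [silu, neg_neg, norm_div, norm_neg, Real.norm_of_nonneg hx, pow_one, Real.exp_neg,
    Real.norm_of_nonneg (by positivity), div_eq_mul_inv]
  gcongr
  linarith

/-- `silu` is not a polynomial. -/
theorem not_polynomial_silu (p : Polynomial ℝ) : ¬ ∀ x, silu x = p.eval x := by
  intro h
  have h1 : Filter.Tendsto (fun x => (p.comp (-Polynomial.X)).eval x) Filter.atTop (nhds 0) := by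
    refine tendsto_silu_neg_atTop.congr fun x => ?_
    simp [h]
  have h2 := ((p.comp (-Polynomial.X)).tendsto_nhds_iff.1 h1).1
  rw [Polynomial.leadingCoeff_eq_zero] at h2
  have h3 := congrArg (Polynomial.eval (-1)) h2
  have h4 := h 1
  simp only [Polynomial.eval_comp, Polynomial.eval_neg, Polynomial.eval_X, neg_neg,
    Polynomial.eval_zero] at h3
  -- A polynomial with a limit at infinity is constant, here 0 because SiLU tends to 0 at `-∞`; but
  -- SiLU is nonzero at 1.
  rw [h3, silu, div_eq_zero_iff] at h4
  have := one_add_exp_neg_pos 1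
  rcases h4 with h4 | h4 <;> linarith

/-- Taylor's formula with the Lagrange remainder, for a smooth function on the line. -/
theorem exists_eq_sum_iteratedDeriv_add_remainder {f : ℝ → ℝ} (hf : ContDiff ℝ ∞ f) (n : ℕ)
    {x₀ x : ℝ} (hx : x₀ ≠ x) :
    ∃ y ∈ Set.uIoo x₀ x, f x =
      ∑ k ∈ Finset.range (n + 1), (k.factorial : ℝ)⁻¹ * iteratedDeriv k f x₀ * (x - x₀) ^ k +
        iteratedDeriv (n + 1) f y * (x - x₀) ^ (n + 1) / (n + 1).factorial := by
  obtain ⟨y, hy, h⟩ := taylor_mean_remainder_lagrange_iteratedDeriv (n := n) hx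
    (hf.of_le (by exact_mod_cast le_top)).contDiffOn
  refine ⟨y, hy, ?_⟩
  rw [← h, taylor_within_apply, ← sub_eq_iff_eq_add, sub_sub_cancel]
  refine Finset.sum_congr rfl fun k _ => ?_
  rw [iteratedDerivWithin_eq_iteratedDeriv (uniqueDiffOn_uIcc hx)
    (hf.of_le (by exact_mod_cast le_top)).contDiffAt (by simp), smul_eq_mul]
  ring

/-- The Lagrange remainder vanishes, so the function equals its Taylor polynomial at 0. -/
theorem exists_polynomial_of_iteratedDeriv_eq_zero {f : ℝ → ℝ} (n : ℕ) (hf : ContDiff ℝ ∞ f)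
    (h : ∀ x, iteratedDeriv (n + 1) f x = 0) : ∃ p : Polynomial ℝ, ∀ x, f x = p.eval x := by
  refine ⟨∑ k ∈ Finset.range (n + 1),
    Polynomial.C ((k.factorial : ℝ)⁻¹ * iteratedDeriv k f 0) * Polynomial.X ^ k, fun x => ?_⟩
  simp only [Polynomial.eval_finsetSum, Polynomial.eval_mul, Polynomial.eval_C,
    Polynomial.eval_pow, Polynomial.eval_X]
  rcases eq_or_ne 0 x with rfl | hx
  · simp [Finset.sum_range_succ']
  obtain ⟨y, -, hy⟩ := exists_eq_sum_iteratedDeriv_add_remainder hf n hx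
  rwa [h, zero_mul, zero_div, add_zero, sub_zero] at hy

theorem exists_iteratedDeriv_silu_ne_zero (n : ℕ) : ∃ b, iteratedDeriv n silu b ≠ 0 := by
  by_contra! h
  cases n with
  | zero => exact not_polynomial_silu 0 (by simpa using h)
  | succ n =>
    obtain ⟨p, hp⟩ := exists_polynomial_of_iteratedDeriv_eq_zero n contDiff_silu h
    exact not_polynomial_silu p hp

/-! ### Powers by finite differences, products by polarization -/

/-- This is the `K`-th forward difference of a power at 0: it kills the lower powers and sends the
`K`-th to `K!`. -/
theorem sum_alternating_choose_mul_pow {k K : ℕ} (h : k ≤ K) :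
    ∑ j ∈ Finset.range (K + 1), (-1 : ℝ) ^ (K - j) * K.choose j * (j : ℝ) ^ k =
      if k = K then (K.factorial : ℝ) else 0 := by
  have h1 := fwdDiff_iter_eq_sum_shift (1 : ℝ) (fun r : ℝ => r ^ k) K 0
  simp only [zero_add, nsmul_eq_mul, mul_one, zsmul_eq_mul] at h1
  push_cast at h1
  rw [← h1]
  split_ifs with hk
  · subst hk
    rw [fwdDiff_iter_eq_factorial]; simp
  · rw [fwdDiff_iter_pow_eq_zero_of_lt (lt_of_le_of_ne h hk)]; simp

/-- Finite differences of a smooth function approximate a power. -/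
theorem exists_sum_affine_comp_approx_pow {f : ℝ → ℝ} (hf : ContDiff ℝ ∞ f) {K : ℕ} {b : ℝ}
    (hb : iteratedDeriv K f b ≠ 0) {R η : ℝ} (hR : 0 < R) (hη : 0 < η) :
    ∃ a w : Fin (K + 1) → ℝ, ∀ t, |t| ≤ R → |t ^ K - ∑ j, a j * f (w j * t + b)| ≤ η := by
  set D := iteratedDeriv K f b
  have hD : 0 < |D| := abs_pos.2 hb
  -- The binomial weights sum to `2 ^ K`, each Taylor error is at most `η / M * (K * δ * R) ^ K`,
  -- and the division by `δ ^ K * |D|` cancels `δ`. So `M` can be fixed before `δ`.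
  set M : ℝ := 2 ^ K * (K * R) ^ K / |D| + 1
  have hM : 0 < M := by positivity
  have ho := (taylor_isLittleO_univ (n := K) (x₀ := b)
    (hf.of_le (by exact_mod_cast le_top))).bound (show 0 < η / M by positivity)
  obtain ⟨r, hr, hball⟩ := Metric.eventually_nhds_iff.1 ho
  obtain ⟨δ, hδ, hδr⟩ : ∃ δ : ℝ, 0 < δ ∧ K * δ * R < r := by
    refine ⟨r / (2 * (K + 1) * R), by positivity, ?_⟩
    rw [mul_div_assoc', div_mul_eq_mul_div, div_lt_iff₀ (by positivity)]
    have : 0 < r * R := by positivity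
    nlinarith [(Nat.cast_nonneg K : (0 : ℝ) ≤ K)]
  set s : ℕ → ℝ := fun j => (-1 : ℝ) ^ (K - j) * K.choose j
  refine ⟨fun j => s j / (δ ^ K * D), fun j => j * δ, fun t ht => ?_⟩
  set T : ℝ → ℝ := taylorWithinEval f K Set.univ b
  have hT : ∑ j ∈ Finset.range (K + 1), s j * T (j * δ * t + b) = (δ * t) ^ K * D := by
    simp only [T, taylor_within_apply, add_sub_cancel_right, smul_eq_mul, Finset.mul_sum]
    rw [Finset.sum_comm]
    have : ∀ k ∈ Finset.range (K + 1), ∑ j ∈ Finset.range (K + 1),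
        s j * ((k.factorial : ℝ)⁻¹ * (j * δ * t) ^ k * iteratedDerivWithin k f Set.univ b) =
        (if k = K then (K.factorial : ℝ) else 0) *
          ((k.factorial : ℝ)⁻¹ * (δ * t) ^ k * iteratedDerivWithin k f Set.univ b) := by
      intro k hk
      rw [← sum_alternating_choose_mul_pow (Nat.lt_succ_iff.1 (Finset.mem_range.1 hk)),
        Finset.sum_mul]
      refine Finset.sum_congr rfl fun j _ => ?_
      simp only [s]; ring
    rw [Finset.sum_congr rfl this, Finset.sum_eq_single_of_mem K (by simp)]
    · simp only [if_true, iteratedDerivWithin_univ]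
      have : (K.factorial : ℝ) ≠ 0 := by positivity
      field_simp
      rfl
    · intro k _ hk
      simp [hk]
  have hsum : (∑ j : Fin (K + 1), s j / (δ ^ K * D) * f (j * δ * t + b)) =
      (∑ j ∈ Finset.range (K + 1), s j * f (j * δ * t + b)) / (δ ^ K * D) := by
    rw [Finset.sum_div, Finset.sum_range]
    refine Finset.sum_congr rfl fun j _ => ?_
    ring
  have hpow : t ^ K = (∑ j ∈ Finset.range (K + 1), s j * T (j * δ * t + b)) / (δ ^ K * D) := by
    rw [hT, mul_pow]
    field_simp
  rw [hsum, hpow, ← sub_div, ← Finset.sum_sub_distrib, abs_div, abs_mul, abs_of_pos (pow_pos hδ K),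
    div_le_iff₀ (by positivity)]
  have hterm : ∀ j ∈ Finset.range (K + 1),
      |s j * T (j * δ * t + b) - s j * f (j * δ * t + b)| ≤
        K.choose j * (η / M * (K * δ * R) ^ K) := by
    intro j hj
    have hjK : (j : ℝ) ≤ K := by exact_mod_cast Nat.lt_succ_iff.1 (Finset.mem_range.1 hj)
    have hle : |j * δ * t| ≤ K * δ * R := by
      rw [abs_mul, abs_of_nonneg (by positivity : 0 ≤ (j : ℝ) * δ)]
      gcongr
    have := hball (y := j * δ * t + b) (by
      rw [Real.dist_eq, add_sub_cancel_right]; exact hle.trans_lt hδr)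
    rw [add_sub_cancel_right, norm_pow, Real.norm_eq_abs, Real.norm_eq_abs] at this
    rw [← mul_sub, abs_mul, abs_sub_comm]
    refine mul_le_mul (by simp [s, abs_mul]) (this.trans ?_) (abs_nonneg _) (by positivity)
    gcongr
  refine (Finset.abs_sum_le_sum_abs _ _).trans ((Finset.sum_le_sum hterm).trans ?_)
  rw [← Finset.sum_mul]
  have h2 : ∑ j ∈ Finset.range (K + 1), (K.choose j : ℝ) = 2 ^ K := by
    exact_mod_cast Nat.sum_range_choose K
  rw [h2]
  have h3 : 2 ^ K * (K * R) ^ K ≤ M * |D| := by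
    simp only [M, add_mul, one_mul]
    rw [div_mul_cancel₀ _ hD.ne']
    linarith
  calc 2 ^ K * (η / M * (K * δ * R) ^ K) = (2 ^ K * (K * R) ^ K) * (η / M * δ ^ K) := by
        rw [show (K : ℝ) * δ * R = K * R * δ by ring, mul_pow (K * R : ℝ) δ]; ring
    _ ≤ M * |D| * (η / M * δ ^ K) := by gcongr
    _ = η * (δ ^ K * |D|) := by field_simp

/-- Polarization: a product is a combination of powers of partial sums. -/
theorem sum_neg_one_pow_card_mul_sum_compl_pow {κ : Type*} [Fintype κ] [DecidableEq κ]
    (y : κ → ℝ) :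
    ∑ S : Finset κ, (-1 : ℝ) ^ S.card * (∑ k ∈ Sᶜ, y k) ^ Fintype.card κ =
      (Fintype.card κ).factorial * ∏ k, y k := by
  have h1 : ∀ S : Finset κ, (∑ k ∈ Sᶜ, y k) ^ Fintype.card κ =
      ∑ p : κ → κ, if S ⊆ (Finset.univ.image p)ᶜ then ∏ i, y (p i) else 0 := by
    intro S
    have := Finset.prod_univ_sum (fun _ : κ => Sᶜ) (fun _ k => y k)
    rw [Finset.prod_const, Finset.card_univ] at this
    rw [this, ← Finset.sum_filter]
    refine Finset.sum_congr ?_ fun _ _ => rfl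
    ext p
    simp only [Fintype.mem_piFinset, Finset.mem_compl, Finset.mem_filter, Finset.mem_univ,
      true_and, Finset.subset_iff, Finset.mem_image, not_exists]
    exact ⟨fun h x hx i hi => h i (hi ▸ hx), fun h i hi => h hi i rfl⟩
  -- Inclusion-exclusion: the signed sum over the sets that avoid the image of `p` vanishes unless
  -- `p` is onto, so only the permutations survive.
  have h2 : ∀ p : κ → κ, ∑ S : Finset κ, (-1 : ℝ) ^ S.card *
      (if S ⊆ (Finset.univ.image p)ᶜ then ∏ i, y (p i) else 0) =
      if Function.Bijective p then ∏ k, y k else 0 := by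
    intro p
    have h3 := Finset.sum_powerset_neg_one_pow_card (x := (Finset.univ.image p)ᶜ)
    have h4 : ∑ S ∈ (Finset.univ.image p)ᶜ.powerset, (-1 : ℝ) ^ S.card =
        if (Finset.univ.image p)ᶜ = ∅ then 1 else 0 := by
      exact_mod_cast congrArg (Int.cast (R := ℝ)) h3
    simp only [mul_ite, mul_zero]
    rw [← Finset.sum_filter, ← Finset.sum_mul]
    have h5 : (Finset.univ.filter fun S => S ⊆ (Finset.univ.image p)ᶜ) =
        (Finset.univ.image p)ᶜ.powerset := by ext; simp
    rw [h5, h4]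
    have h6 : (Finset.univ.image p)ᶜ = ∅ ↔ Function.Bijective p := by
      rw [Finset.compl_eq_empty_iff, ← Finite.surjective_iff_bijective, Finset.eq_univ_iff_forall]
      simp [Function.Surjective]
    simp only [h6, ite_mul, one_mul, zero_mul]
    split_ifs with h
    · exact h.prod_comp y
    · rfl
  simp only [h1, Finset.mul_sum]
  rw [Finset.sum_comm, Finset.sum_congr rfl fun p _ => h2 p, ← Finset.sum_filter,
    Finset.sum_const, nsmul_eq_mul]
  congr 2
  rw [← Fintype.card_perm, ← Fintype.card_subtype]
  exact Fintype.card_congr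
    { toFun := fun p => Equiv.ofBijective p.1 p.2
      invFun := fun e => ⟨e, e.bijective⟩
      left_inv := fun _ => rfl
      right_inv := fun _ => by ext; rfl }

/-- The index set of the neurons that approximate a product over `κ`. -/
abbrev ProdIndex (κ : Type) [Fintype κ] : Type := Finset κ × Fin (Fintype.card κ + 1)

/-- One hidden layer of a fixed size approximates a product arbitrarily well. -/
theorem exists_silu_layer_approx_prod (κ : Type) [Fintype κ] [DecidableEq κ] {R η : ℝ}
    (hR : 0 < R) (hη : 0 < η) :
    ∃ (e β : ProdIndex κ → ℝ) (v : ProdIndex κ → κ → ℝ), ∀ y : κ → ℝ, (∀ k, |y k| ≤ R) →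
      |∏ k, y k - ∑ i, e i * silu (∑ k, v i k * y k + β i)| ≤ η := by
  set K := Fintype.card κ with hK
  obtain ⟨b, hb⟩ := exists_iteratedDeriv_silu_ne_zero K
  have hR' : 0 < K * R + 1 := by positivity
  obtain ⟨a, w, h⟩ := exists_sum_affine_comp_approx_pow contDiff_silu hb hR'
    (show 0 < η / 2 ^ K by positivity)
  have hfac : (0 : ℝ) < K.factorial := by positivity
  have hfac1 : (1 : ℝ) ≤ K.factorial := by
    exact_mod_cast Nat.one_le_iff_ne_zero.2 K.factorial_ne_zero
  refine ⟨fun i => (-1) ^ i.1.card * a i.2 / K.factorial, fun _ => b,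
    fun i k => if k ∈ i.1ᶜ then w i.2 else 0, fun y hy => ?_⟩
  have hprod : ∏ k, y k = (∑ S : Finset κ, (-1 : ℝ) ^ S.card * (∑ k ∈ Sᶜ, y k) ^ K) /
      K.factorial := by
    rw [hK, sum_neg_one_pow_card_mul_sum_compl_pow]
    field_simp
  have hlin : ∀ (S : Finset κ) (j : Fin (K + 1)),
      ∑ k, (if k ∈ Sᶜ then w j else 0) * y k = w j * ∑ k ∈ Sᶜ, y k := by
    intro S j
    simp only [ite_mul, zero_mul]
    rw [← Finset.sum_filter, Finset.mul_sum, Finset.filter_mem_eq_inter, Finset.univ_inter]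
  have hnet : ∑ i : ProdIndex κ, (-1) ^ i.1.card * a i.2 / K.factorial *
      silu (∑ k, (if k ∈ i.1ᶜ then w i.2 else 0) * y k + b) =
      (∑ S : Finset κ, (-1 : ℝ) ^ S.card * ∑ j, a j * silu (w j * (∑ k ∈ Sᶜ, y k) + b)) /
      K.factorial := by
    rw [Fintype.sum_prod_type, Finset.sum_div]
    refine Finset.sum_congr rfl fun S _ => ?_
    rw [Finset.mul_sum, Finset.sum_div]
    refine Finset.sum_congr rfl fun j _ => ?_
    simp only [hlin]
    ring
  rw [hnet, hprod, ← sub_div, abs_div, abs_of_pos hfac, div_le_iff₀ hfac, ← Finset.sum_sub_distrib]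
  refine (Finset.abs_sum_le_sum_abs _ _).trans ?_
  have hbound : ∀ S ∈ (Finset.univ : Finset (Finset κ)),
      |(-1 : ℝ) ^ S.card * (∑ k ∈ Sᶜ, y k) ^ K -
        (-1 : ℝ) ^ S.card * ∑ j, a j * silu (w j * (∑ k ∈ Sᶜ, y k) + b)| ≤ η / 2 ^ K := by
    intro S _
    rw [← mul_sub, abs_mul, abs_pow, abs_neg, abs_one, one_pow, one_mul]
    apply h
    calc |∑ k ∈ Sᶜ, y k| ≤ ∑ k ∈ Sᶜ, |y k| := Finset.abs_sum_le_sum_abs _ _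
      _ ≤ ∑ k ∈ Sᶜ, R := Finset.sum_le_sum fun k _ => hy k
      _ = (Sᶜ.card : ℝ) * R := by simp
      _ ≤ K * R := by
        gcongr
        exact Finset.card_le_univ _
      _ ≤ K * R + 1 := by linarith
  refine (Finset.sum_le_sum hbound).trans ?_
  rw [Finset.sum_const, Finset.card_univ, Fintype.card_finset, nsmul_eq_mul]
  push_cast
  rw [mul_div_cancel₀ _ (by positivity)]
  nlinarith

/-! ### Two hidden layers for a product, and their parallel assembly -/

/-- A combination of three rectified affine functions. -/
noncomputable def reluSum {d : ℕ} (a b : Fin 3 → ℝ) (w : Fin 3 → Fin d → ℝ) (x : Fin d → ℝ) : ℝ :=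
  ∑ j, a j * max (∑ i, w j i * x i + b j) 0

theorem continuous_reluSum {d : ℕ} (a b : Fin 3 → ℝ) (w : Fin 3 → Fin d → ℝ) :
    Continuous (reluSum a b w) := by
  unfold reluSum
  fun_prop

theorem cube_eq_pi (d : ℕ) (B : ℝ) : cube d B = Set.pi Set.univ fun _ => Set.Icc (-B) B := by
  ext x
  simp only [cube, Set.mem_ofPred_eq, Set.mem_univ_pi]

theorem isCompact_cube (d : ℕ) (B : ℝ) : IsCompact (cube d B) := by
  rw [cube_eq_pi]
  exact isCompact_univ_pi fun _ => isCompact_Icc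

/-- The function computed by two hidden layers with neurons `A` and `ι`. -/
noncomputable def twoLayer {d : ℕ} {A ι : Type} [Fintype A] [Fintype ι] (e β : ι → ℝ) (v : ι → A → ℝ)
    (w : A → Fin d → ℝ) (b : A → ℝ) (x : Fin d → ℝ) : ℝ :=
  ∑ i, e i * silu (∑ k, v i k * silu (∑ j, w k j * x j + b k) + β i)

/-- Two hidden layers of a fixed size approximate a product of rectified sums arbitrarily well. -/
theorem exists_twoLayer_approx_prod_reluSum {d : ℕ} (κ : Type) [Fintype κ] [DecidableEq κ] (B : ℝ)
    (a b : κ → Fin 3 → ℝ) (w : κ → Fin 3 → Fin d → ℝ) {η : ℝ} (hη : 0 < η) :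
    ∃ (e β : ProdIndex κ → ℝ) (v : ProdIndex κ → κ × Fin 3 → ℝ) (w' : κ × Fin 3 → Fin d → ℝ)
      (b' : κ × Fin 3 → ℝ), ∀ x ∈ cube d B,
      |∏ k, reluSum (a k) (b k) (w k) x - twoLayer e β v w' b' x| ≤ η := by
  set u : (Fin d → ℝ) → κ → ℝ := fun x k => reluSum (a k) (b k) (w k) x with hu
  have hucont : Continuous u := continuous_pi fun k => continuous_reluSum _ _ _
  obtain ⟨R, hR, hRu⟩ : ∃ R : ℝ, 0 < R ∧ ∀ x ∈ cube d B, ‖u x‖ ≤ R := by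
    obtain ⟨R, hR⟩ := (isCompact_cube d B).exists_bound_of_continuousOn hucont.continuousOn
    exact ⟨max R 1, by positivity, fun x hx => (hR x hx).trans (le_max_left _ _)⟩
  have hR1 : 0 < R + 1 := by linarith
  obtain ⟨e, β, v, hv⟩ := exists_silu_layer_approx_prod κ hR1 (half_pos hη)
  have huc := (isCompact_closedBall (0 : κ → ℝ) (R + 1)).uniformContinuousOn_of_continuous
    (f := fun y => ∏ k, y k) (by fun_prop)
  rw [Metric.uniformContinuousOn_iff_le] at huc
  obtain ⟨δ, hδ, hprod⟩ := huc (η / 2) (half_pos hη)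
  set M : ℝ := ∑ k, ∑ j, |a k j| + 1
  have hM : 0 < M := by positivity
  -- This scale puts each factor within `min δ 1` of its target: `δ` for the uniform continuity of
  -- the product, 1 to stay in the ball of radius `R + 1`.
  set l : ℝ := M / min δ 1
  have hl : 0 < l := by positivity
  set z : (Fin d → ℝ) → κ → ℝ := fun x k =>
    ∑ j, a k j / l * silu (∑ i, l * w k j i * x i + l * b k j) with hz
  have huz : ∀ x, ‖u x - z x‖ ≤ min δ 1 := by
    intro x
    rw [pi_norm_le_iff_of_nonneg (by positivity)]
    intro k
    have h1 : (u x - z x) k = -∑ j, a k j * (silu (l * (∑ i, w k j i * x i + b k j)) / l -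
        max (∑ i, w k j i * x i + b k j) 0) := by
      simp only [hu, hz, reluSum, Pi.sub_apply, ← Finset.sum_sub_distrib, ← Finset.sum_neg_distrib]
      refine Finset.sum_congr rfl fun j _ => ?_
      simp only [mul_add, Finset.mul_sum, mul_assoc]
      ring
    rw [h1, norm_neg]
    refine (norm_sum_le _ _).trans ?_
    calc _ ≤ ∑ j, |a k j| * (1 / l) := by
          refine Finset.sum_le_sum fun j _ => ?_
          rw [norm_mul, Real.norm_eq_abs, Real.norm_eq_abs]
          gcongr
          exact abs_silu_mul_div_sub_max_le hl _
      _ = (∑ j, |a k j|) * (1 / l) := by rw [Finset.sum_mul]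
      _ ≤ M * (1 / l) := by
          gcongr
          have := Finset.single_le_sum (f := fun k => ∑ j, |a k j|)
            (fun k _ => Finset.sum_nonneg fun j _ => abs_nonneg _) (Finset.mem_univ k)
          simp only [M]
          linarith
      _ = min δ 1 := by simp only [l]; field_simp
  -- The linear combination that forms each factor is merged into the weights of the second layer,
  -- so it needs no layer of its own.
  refine ⟨e, β, fun i kj => v i kj.1 * (a kj.1 kj.2 / l), fun kj i => l * w kj.1 kj.2 i,
    fun kj => l * b kj.1 kj.2, fun x hx => ?_⟩
  have hnet : twoLayer e β (fun i (kj : κ × Fin 3) => v i kj.1 * (a kj.1 kj.2 / l))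
      (fun kj i => l * w kj.1 kj.2 i) (fun kj => l * b kj.1 kj.2) x =
      ∑ i, e i * silu (∑ k, v i k * z x k + β i) := by
    simp only [twoLayer, Fintype.sum_prod_type, hz, Finset.mul_sum, mul_assoc]
  have hzR : ‖z x‖ ≤ R + 1 := by
    have h1 := norm_sub_norm_le (z x) (u x)
    rw [norm_sub_rev] at h1
    linarith [huz x, min_le_right δ 1, hRu x hx]
  have h1 := hprod (u x) (by simpa using (hRu x hx).trans (by linarith)) (z x) (by simpa using hzR)
    (by rw [dist_eq_norm]; exact (huz x).trans (min_le_left _ _))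
  have h2 := hv (z x) fun k => (norm_le_pi_norm (z x) k).trans hzR
  rw [hnet]
  rw [Real.dist_eq] at h1
  calc _ ≤ |∏ k, u x k - ∏ k, z x k| + |∏ k, z x k - ∑ i, e i * silu (∑ k, v i k * z x k + β i)| :=
        abs_sub_le _ _ _
    _ ≤ η := by linarith

theorem ncard_le_of_subset_range {α β : Type*} [Fintype α] (s : Set β) (f : α → β)
    (h : s ⊆ Set.range f) : s.ncard ≤ Fintype.card α := by
  classical
  refine (Set.ncard_le_ncard h (Set.finite_range f)).trans ?_
  rw [← Set.image_univ]
  refine (Set.ncard_image_le).trans ?_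
  rw [Set.ncard_univ, Nat.card_eq_fintype_card]

/-- A weighted sum of two-layer functions is computed by a network with block diagonal second
layer. -/
theorem exists_net_eval_eq_sum_twoLayer {d : ℕ} {T A ι : Type} [Fintype T] [Fintype A] [Fintype ι]
    (c : T → ℝ) (e β : T → ι → ℝ) (v : T → ι → A → ℝ) (w : T → A → Fin d → ℝ) (b : T → A → ℝ) :
    ∃ N : SiLUNet 1 d,
      (∀ x, N.eval x 0 = ∑ t, c t * twoLayer (e t) (β t) (v t) (w t) (b t) x) ∧
      N.size ≤ Fintype.card T * (Fintype.card A * (d + 2) +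
        Fintype.card ι * (Fintype.card A + 3)) + 2 ∧
      N.depth = 3 := by
  classical
  let p := Fintype.equivFin (T × A)
  let q := Fintype.equivFin (T × ι)
  let W₁ : Matrix (Fin (Fintype.card (T × A))) (Fin d) ℝ :=
    fun i j => w (p.symm i).1 (p.symm i).2 j
  let b₁ : Fin (Fintype.card (T × A)) → ℝ := fun i => b (p.symm i).1 (p.symm i).2
  let W₂ : Matrix (Fin (Fintype.card (T × ι))) (Fin (Fintype.card (T × A))) ℝ :=
    fun i j => if (q.symm i).1 = (p.symm j).1 then v (q.symm i).1 (q.symm i).2 (p.symm j).2 else 0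
  let b₂ : Fin (Fintype.card (T × ι)) → ℝ := fun i => β (q.symm i).1 (q.symm i).2
  let W₃ : Matrix (Fin 1) (Fin (Fintype.card (T × ι))) ℝ :=
    fun _ j => c (q.symm j).1 * e (q.symm j).1 (q.symm j).2
  refine ⟨.hidden W₁ b₁ (.hidden W₂ b₂ (.output W₃ 0)), fun x => ?_, ?_, rfl⟩
  · simp only [SiLUNet.eval, Matrix.mulVec, dotProduct, Pi.add_apply, Pi.zero_apply, add_zero, W₃,
      W₂, b₂, W₁, b₁]
    rw [← q.sum_comp]
    simp only [Equiv.symm_apply_apply, Fintype.sum_prod_type, twoLayer, Finset.mul_sum]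
    refine Finset.sum_congr rfl fun t _ => Finset.sum_congr rfl fun i _ => ?_
    rw [← p.sum_comp]
    simp only [Equiv.symm_apply_apply, Fintype.sum_prod_type, ite_mul, zero_mul]
    rw [Finset.sum_eq_single t (fun s _ hs => by simp [Ne.symm hs]) (by simp)]
    simp [mul_assoc]
  · simp only [SiLUNet.size, SiLUNet.layerParams]
    have h1 := Set.ncard_le_card {ij : Fin (Fintype.card (T × A)) × Fin d | W₁ ij.1 ij.2 ≠ 0}
    have h2 := Set.ncard_le_card {i | b₁ i ≠ 0}
    -- The blocks do not interact, so the nonzero weights inject into `T × ι × A`. This keeps the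
    -- size linear, not quadratic, in the number of summands.
    have h3 := ncard_le_of_subset_range {ij : Fin (Fintype.card (T × ι)) ×
      Fin (Fintype.card (T × A)) | W₂ ij.1 ij.2 ≠ 0}
      (fun s : T × ι × A => (q (s.1, s.2.1), p (s.1, s.2.2))) (by
        rintro ⟨i, j⟩ hij
        have hij' : (q.symm i).1 = (p.symm j).1 := by
          by_contra hne
          exact hij (by simp [W₂, hne])
        refine ⟨((q.symm i).1, (q.symm i).2, (p.symm j).2), ?_⟩
        simp only [Prod.mk.eta, Equiv.apply_symm_apply, Prod.mk.injEq, true_and]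
        rw [hij']
        simp)
    have h4 := Set.ncard_le_card {i | b₂ i ≠ 0}
    have h5 := Set.ncard_le_card {ij : Fin 1 × Fin (Fintype.card (T × ι)) | W₃ ij.1 ij.2 ≠ 0}
    have h6 : Set.ncard {i : Fin 1 | (0 : Fin 1 → ℝ) i ≠ 0} = 0 := by simp
    simp only [Nat.card_eq_fintype_card, Fintype.card_prod, Fintype.card_fin] at h1 h2 h3 h4 h5 h6 ⊢
    rw [h6]
    nlinarith

/-- A sum of products of rectified sums is approximated arbitrarily well by networks of a size
proportional to the number of the summands. -/
theorem exists_net_approx_sum_prod_reluSum {d : ℕ} {T : Type} [Fintype T] (κ : Type) [Fintype κ]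
    [DecidableEq κ] (B : ℝ) (c : T → ℝ) (a b : T → κ → Fin 3 → ℝ)
    (w : T → κ → Fin 3 → Fin d → ℝ) {η : ℝ} (hη : 0 < η) :
    ∃ N : SiLUNet 1 d,
      (∀ x ∈ cube d B,
        |∑ t, c t * ∏ k, reluSum (a t k) (b t k) (w t k) x - N.eval x 0| ≤ η) ∧
      N.size ≤ Fintype.card T * (Fintype.card (κ × Fin 3) * (d + 2) +
        Fintype.card (ProdIndex κ) * (Fintype.card (κ × Fin 3) + 3)) + 2 ∧
      N.depth = 3 := by
  set M : ℝ := ∑ t, |c t| + 1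
  have hM : 0 < M := by positivity
  choose e β v w' b' h using fun t =>
    exists_twoLayer_approx_prod_reluSum κ B (a t) (b t) (w t) (show 0 < η / M by positivity)
  obtain ⟨N, hN, hsize, hdepth⟩ := exists_net_eval_eq_sum_twoLayer c e β v w' b'
  refine ⟨N, fun x hx => ?_, hsize, hdepth⟩
  rw [hN, ← Finset.sum_sub_distrib]
  refine (Finset.abs_sum_le_sum_abs _ _).trans ?_
  calc _ ≤ ∑ t, |c t| * (η / M) := by
        refine Finset.sum_le_sum fun t _ => ?_
        rw [← mul_sub, abs_mul]
        gcongr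
        exact h t x hx
    _ = (∑ t, |c t|) * (η / M) := by rw [Finset.sum_mul]
    _ ≤ M * (η / M) := by gcongr; simp only [M]; linarith
    _ = η := by field_simp

/-! ### Iterated partial derivatives and Taylor's theorem in several variables -/

/-- The iterated partial derivative along a list of coordinates. -/
noncomputable def listDeriv {d : ℕ} (l : List (Fin d)) (φ : (Fin d → ℝ) → ℝ) : (Fin d → ℝ) → ℝ :=
  l.foldr partialDeriv φ

theorem listDeriv_cons {d : ℕ} (i : Fin d) (l : List (Fin d)) (φ : (Fin d → ℝ) → ℝ) :
    listDeriv (i :: l) φ = partialDeriv i (listDeriv l φ) := rfl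

theorem ContDiff.partialDeriv {d : ℕ} {φ : (Fin d → ℝ) → ℝ} (hφ : ContDiff ℝ ∞ φ) (i : Fin d) :
    ContDiff ℝ ∞ (partialDeriv i φ) :=
  (hφ.fderiv_right (m := ∞) le_rfl).clm_apply contDiff_const

theorem ContDiff.listDeriv {d : ℕ} {φ : (Fin d → ℝ) → ℝ} (hφ : ContDiff ℝ ∞ φ)
    (l : List (Fin d)) : ContDiff ℝ ∞ (listDeriv l φ) := by
  induction l with
  | nil => exact hφ
  | cons i l ih => exact ih.partialDeriv i

theorem partialDeriv_comm {d : ℕ} {φ : (Fin d → ℝ) → ℝ} (hφ : ContDiff ℝ ∞ φ) (i j : Fin d) :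
    partialDeriv i (partialDeriv j φ) = partialDeriv j (partialDeriv i φ) := by
  have hd : Differentiable ℝ (fderiv ℝ φ) :=
    (hφ.fderiv_right (m := ∞) le_rfl).differentiable (by simp)
  have h : ∀ (i j : Fin d) (x : Fin d → ℝ), partialDeriv i (partialDeriv j φ) x =
      fderiv ℝ (fderiv ℝ φ) x (Pi.single i 1) (Pi.single j 1) := by
    intro i j x
    unfold partialDeriv
    rw [fderiv_clm_apply (hd x) (differentiableAt_const _)]
    simp
  have hs : ∀ x, IsSymmSndFDerivAt ℝ φ x := fun x =>
    hφ.contDiffAt.isSymmSndFDerivAt (by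
      rw [minSmoothness_of_isRCLikeNormedField]; exact WithTop.coe_le_coe.2 le_top)
  ext x
  rw [h, h]
  exact hs x _ _

theorem listDeriv_perm {d : ℕ} {φ : (Fin d → ℝ) → ℝ} (hφ : ContDiff ℝ ∞ φ)
    {l l' : List (Fin d)} (h : l.Perm l') : listDeriv l φ = listDeriv l' φ := by
  induction h with
  | nil => rfl
  | cons i _ ih => rw [listDeriv_cons, listDeriv_cons, ih]
  | swap i j l => exact partialDeriv_comm (hφ.listDeriv l) j i
  | trans _ _ ih₁ ih₂ => exact ih₁.trans ih₂

theorem multiDeriv_eq_listDeriv {d : ℕ} (α : Fin d → ℕ) (φ : (Fin d → ℝ) → ℝ) :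
    multiDeriv α φ = listDeriv ((List.finRange d).flatMap fun i => List.replicate (α i) i) φ := by
  unfold multiDeriv listDeriv
  induction List.finRange d with
  | nil => rfl
  | cons i l ih =>
    have h : ∀ (m : ℕ) (ψ : (Fin d → ℝ) → ℝ),
        (List.replicate m i).foldr partialDeriv ψ = (partialDeriv i)^[m] ψ := by
      intro m ψ
      induction m with
      | zero => rfl
      | succ m ihm => rw [List.replicate_succ, List.foldr_cons, ihm, Function.iterate_succ_apply']
    rw [List.foldr_cons, ih, List.flatMap_cons, List.foldr_append, h]

/-- Partial derivatives of a smooth function commute, so only the multiplicities matter. This links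
the weak derivatives, given by multi-indices, to Taylor sums over words of coordinates. -/
theorem multiDeriv_count {d : ℕ} {φ : (Fin d → ℝ) → ℝ} (hφ : ContDiff ℝ ∞ φ)
    (l : List (Fin d)) : multiDeriv (fun i => l.count i) φ = listDeriv l φ := by
  rw [multiDeriv_eq_listDeriv]
  refine listDeriv_perm hφ (List.perm_iff_count.2 fun j => ?_)
  rw [List.count_flatMap, ← Fin.sum_univ_def]
  simp only [Function.comp_apply, List.count_replicate]
  simp

theorem sum_count_eq_length {d : ℕ} (l : List (Fin d)) : ∑ i, l.count i = l.length := by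
  simpa using Multiset.sum_count_eq_card (s := Finset.univ) (m := (l : Multiset (Fin d)))

theorem hasDerivAt_comp_line {d : ℕ} {F : (Fin d → ℝ) → ℝ} (hF : ContDiff ℝ ∞ F)
    (x v : Fin d → ℝ) (t : ℝ) :
    HasDerivAt (fun t : ℝ => F (x + t • v)) (∑ i, v i * partialDeriv i F (x + t • v)) t := by
  have h1 : HasDerivAt (fun t : ℝ => x + t • v) v t := by
    simpa using ((hasDerivAt_id t).smul_const v).const_add x
  have h2 := ((hF.differentiable (by simp)) (x + t • v)).hasFDerivAt.comp_hasDerivAt t h1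
  refine h2.congr_deriv ?_
  generalize x + t • v = z
  conv_lhs => rw [← Finset.univ_sum_single v]
  rw [map_sum]
  refine Finset.sum_congr rfl fun i _ => ?_
  rw [show Pi.single i (v i) = v i • Pi.single (M := fun _ : Fin d => ℝ) i 1 by
    rw [← Pi.single_smul, smul_eq_mul, mul_one], map_smul, smul_eq_mul, partialDeriv]

/-- Summing over words instead of multi-indices avoids multinomial coefficients; the induction
prepends one letter. -/
theorem iteratedDeriv_comp_line {d : ℕ} {F : (Fin d → ℝ) → ℝ} (hF : ContDiff ℝ ∞ F)
    (x v : Fin d → ℝ) (k : ℕ) :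
    iteratedDeriv k (fun t : ℝ => F (x + t • v)) = fun t => ∑ i : Fin k → Fin d,
      (∏ j, v (i j)) * listDeriv (List.ofFn i) F (x + t • v) := by
  induction k with
  | zero =>
    ext t
    simp [listDeriv]
  | succ k ih =>
    ext t
    rw [iteratedDeriv_succ, ih]
    have h := HasDerivAt.fun_sum (u := Finset.univ) fun (i : Fin k → Fin d) _ =>
      (hasDerivAt_comp_line (hF.listDeriv (List.ofFn i)) x v t).const_mul (∏ j, v (i j))
    rw [h.deriv, ← (Fin.consEquiv fun _ => Fin d).sum_comp, Fintype.sum_prod_type, Finset.sum_comm]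
    refine Finset.sum_congr rfl fun i _ => ?_
    rw [Finset.mul_sum]
    refine Finset.sum_congr rfl fun i₀ _ => ?_
    simp only [Fin.consEquiv_apply, Fin.prod_univ_succ, Fin.cons_zero, Fin.cons_succ,
      List.ofFn_succ, listDeriv_cons]
    ring

/-- Taylor's theorem with a bound of the remainder by the partial derivatives of top order. -/
theorem abs_sub_taylor_le {d n : ℕ} (hn : 1 ≤ n) {F : (Fin d → ℝ) → ℝ} (hF : ContDiff ℝ ∞ F)
    {s : Set (Fin d → ℝ)} (hs : Convex ℝ s)
    (hb : ∀ l : List (Fin d), l.length = n → ∀ y ∈ s, |listDeriv l F y| ≤ 1)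
    {x₀ x : Fin d → ℝ} (hx₀ : x₀ ∈ s) (hx : x ∈ s) {h : ℝ} (hh : ∀ i, |x i - x₀ i| ≤ h) :
    |F x - ∑ k ∈ Finset.range n, (k.factorial : ℝ)⁻¹ * ∑ i : Fin k → Fin d,
      (∏ j, (x (i j) - x₀ (i j))) * listDeriv (List.ofFn i) F x₀| ≤ (d * h) ^ n := by
  obtain ⟨n, rfl⟩ : ∃ m, n = m + 1 := ⟨n - 1, by omega⟩
  set v := x - x₀ with hv
  have hcd : ContDiff ℝ ∞ fun t : ℝ => F (x₀ + t • v) :=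
    hF.comp (contDiff_const.add (contDiff_id.smul contDiff_const))
  obtain ⟨y, hy, heq⟩ := exists_eq_sum_iteratedDeriv_add_remainder hcd n (zero_ne_one (α := ℝ))
  simp only [iteratedDeriv_comp_line hF, one_smul, zero_smul, add_zero, sub_zero, one_pow,
    mul_one, show x₀ + v = x by simp [hv]] at heq
  rw [heq]
  simp only [hv, Pi.sub_apply, add_sub_cancel_left]
  rw [Set.uIoo_of_le zero_le_one] at hy
  have hmem : x₀ + y • v ∈ s := hs.add_smul_sub_mem hx₀ hx ⟨hy.1.le, hy.2.le⟩
  rw [abs_div, Nat.abs_cast]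
  refine (div_le_self (abs_nonneg _) (by
    exact_mod_cast Nat.one_le_iff_ne_zero.2 (Nat.factorial_ne_zero _))).trans ?_
  refine (Finset.abs_sum_le_sum_abs _ _).trans ?_
  have hterm : ∀ i ∈ (Finset.univ : Finset (Fin (n + 1) → Fin d)),
      |(∏ j, (x (i j) - x₀ (i j))) * listDeriv (List.ofFn i) F (x₀ + y • (x - x₀))| ≤
        h ^ (n + 1) := by
    intro i _
    rw [abs_mul, Finset.abs_prod]
    have h1 : ∏ j, |x (i j) - x₀ (i j)| ≤ h ^ (n + 1) := by
      refine (Finset.prod_le_prod (fun j _ => abs_nonneg _) fun j _ => hh (i j)).trans ?_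
      simp
    have h2 := hb (List.ofFn i) (by simp) _ hmem
    exact (mul_le_of_le_one_right (Finset.prod_nonneg fun j _ => abs_nonneg _) h2).trans h1
  refine (Finset.sum_le_sum hterm).trans ?_
  rw [Finset.sum_const, Finset.card_univ, Fintype.card_fun, Fintype.card_fin, Fintype.card_fin,
    nsmul_eq_mul, mul_pow]
  push_cast
  rfl

/-! ### The partition of unity by hat functions -/

/-- The hat function. -/
noncomputable def hat (t : ℝ) : ℝ := max (t + 1) 0 - 2 * max t 0 + max (t - 1) 0

theorem hat_nonneg (t : ℝ) : 0 ≤ hat t := by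
  unfold hat
  rcases max_cases (t + 1) 0 with h | h <;> rcases max_cases t 0 with h' | h' <;>
    rcases max_cases (t - 1) 0 with h'' | h'' <;> linarith

theorem abs_le_one_of_hat_ne_zero {t : ℝ} (ht : hat t ≠ 0) : |t| ≤ 1 := by
  contrapose! ht
  unfold hat
  rcases lt_abs.1 ht with h | h
  · rw [max_eq_left (by linarith), max_eq_left (by linarith), max_eq_left (by linarith)]
    ring
  · rw [max_eq_right (by linarith), max_eq_right (by linarith), max_eq_right (by linarith)]
    ring

/-- A hat is a second difference of the rectifier, so the sum telescopes to a first difference at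
each end. -/
theorem sum_hat_sub_eq_one {N : ℕ} {t : ℝ} (h0 : 0 ≤ t) (hN : t ≤ N) :
    ∑ m : Fin (N + 1), hat (t - (m : ℕ)) = 1 := by
  have h : ∀ M : ℕ, ∑ m ∈ Finset.range M, hat (t - m) =
      (max (t + 1) 0 - max t 0) - (max (t - M + 1) 0 - max (t - M) 0) := by
    intro M
    induction M with
    | zero => simp
    | succ M ih =>
      rw [Finset.sum_range_succ, ih, hat]
      push_cast
      rw [show t - (M + 1) + 1 = t - M by ring, show t - M - 1 = t - (M + 1) by ring]
      ring
  rw [Fin.sum_univ_eq_sum_range (fun m => hat (t - m)), h, max_eq_left (by linarith), max_eq_left h0]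
  push_cast
  rw [max_eq_right (by linarith), max_eq_right (by linarith)]
  ring

/-- The products of hat functions over a grid are a partition of unity. -/
theorem sum_prod_hat_eq_one {d N : ℕ} {t : Fin d → ℝ} (ht : ∀ i, 0 ≤ t i ∧ t i ≤ N) :
    ∑ m : Fin d → Fin (N + 1), ∏ i, hat (t i - (m i : ℕ)) = 1 := by
  rw [← Fintype.piFinset_univ, ← Finset.prod_univ_sum (fun _ => Finset.univ)
    (fun i (m : Fin (N + 1)) => hat (t i - (m : ℕ)))]
  exact Finset.prod_eq_one fun i _ => sum_hat_sub_eq_one (ht i).1 (ht i).2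

/-! ### Mollification -/

/-- Used with `c = -1` for the reflected mollifier and with `c = 1 - θ` for the contraction of the
cube. -/
theorem listDeriv_comp_affine {d : ℕ} {ψ : (Fin d → ℝ) → ℝ} (hψ : ContDiff ℝ ∞ ψ)
    (a : Fin d → ℝ) (c : ℝ) (l : List (Fin d)) :
    listDeriv l (fun x => ψ (a + c • x)) = fun x => c ^ l.length * listDeriv l ψ (a + c • x) := by
  induction l with
  | nil => simp [listDeriv]
  | cons i l ih =>
    ext x
    rw [listDeriv_cons, ih, listDeriv_cons, List.length_cons]
    have hd := ((hψ.listDeriv l).differentiable (by simp) (a + c • x)).hasFDerivAt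
    have h1 : HasFDerivAt (fun x : Fin d → ℝ => a + c • x)
        (c • ContinuousLinearMap.id ℝ (Fin d → ℝ)) x :=
      ((hasFDerivAt_id x).const_smul c).const_add a
    have h2 := (hd.comp x h1).const_mul (c ^ l.length)
    unfold partialDeriv
    refine (congrArg (fun A : (Fin d → ℝ) →L[ℝ] ℝ => A (Pi.single i 1)) h2.fderiv).trans ?_
    simp [pow_succ, mul_assoc]

theorem HasCompactSupport.listDeriv {d : ℕ} {ρ : (Fin d → ℝ) → ℝ} (hρ : HasCompactSupport ρ)
    (l : List (Fin d)) : HasCompactSupport (listDeriv l ρ) := by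
  induction l with
  | nil => exact hρ
  | cons i l ih => exact ih.fderiv_apply ℝ (Pi.single i 1)

/-- The mollification `∫ f(t) ρ(x - t) dt`. -/
noncomputable def mollify {d : ℕ} (f ρ : (Fin d → ℝ) → ℝ) : (Fin d → ℝ) → ℝ :=
  convolution f ρ (ContinuousLinearMap.lsmul ℝ ℝ) volume

theorem mollify_apply {d : ℕ} (f ρ : (Fin d → ℝ) → ℝ) (x : Fin d → ℝ) :
    mollify f ρ x = ∫ t, f t * ρ (x - t) := rfl

theorem mollify_eq_convolution_swap {d : ℕ} (f ρ : (Fin d → ℝ) → ℝ) :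
    mollify f ρ = convolution ρ f (ContinuousLinearMap.lsmul ℝ ℝ) volume := by
  ext x
  rw [mollify_apply, convolution_eq_swap]
  simp [mul_comm]

theorem contDiff_mollify {d : ℕ} {f ρ : (Fin d → ℝ) → ℝ} (hf : LocallyIntegrable f)
    (hρ : ContDiff ℝ ∞ ρ) (hc : HasCompactSupport ρ) : ContDiff ℝ ∞ (mollify f ρ) :=
  hc.contDiff_convolution_right _ hf hρ

theorem listDeriv_mollify {d : ℕ} {f ρ : (Fin d → ℝ) → ℝ} (hf : LocallyIntegrable f)
    (hρ : ContDiff ℝ ∞ ρ) (hc : HasCompactSupport ρ) (l : List (Fin d)) :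
    listDeriv l (mollify f ρ) = mollify f (listDeriv l ρ) := by
  induction l with
  | nil => rfl
  | cons i l ih =>
    ext x
    have hcd : ContDiff ℝ 1 (listDeriv l ρ) := (hρ.listDeriv l).of_le (by exact_mod_cast le_top)
    rw [listDeriv_cons, ih, partialDeriv, mollify,
      ((hc.listDeriv l).hasFDerivAt_convolution_right _ hf hcd x).fderiv,
      convolution_precompR_apply _ hf ((hc.listDeriv l).fderiv ℝ)
        (hcd.continuous_fderiv one_ne_zero)]
    rfl

/-! ### The Sobolev ball: Lipschitz representative and smooth approximation -/

theorem mem_cube_iff_norm_le {d : ℕ} {B : ℝ} (hB : 0 ≤ B) {x : Fin d → ℝ} :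
    x ∈ cube d B ↔ ‖x‖ ≤ B := by
  rw [pi_norm_le_iff_of_nonneg hB]
  simp [cube, abs_le]

theorem cube_eq_closedBall (d : ℕ) {B : ℝ} (hB : 0 ≤ B) :
    cube d B = Metric.closedBall 0 B := by
  ext x
  rw [mem_cube_iff_norm_le hB, mem_closedBall_zero_iff]

theorem ball_subset_interior_cube (d : ℕ) {B : ℝ} (hB : 0 ≤ B) :
    Metric.ball 0 B ⊆ interior (cube d B) := by
  rw [cube_eq_closedBall d hB]
  exact Metric.ball_subset_interior_closedBall

/-- The norm bounds the particular weak derivative chosen by `weakDeriv`, so that choice is the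
witness. -/
theorem exists_isWeakDeriv_of_mem_sobolevBall {n d : ℕ} {B : ℝ} {f : (Fin d → ℝ) → ℝ}
    (hf : f ∈ sobolevBall n d B) {α : Fin d → ℕ} (hα : ∑ i, α i ≤ n) :
    ∃ g, IsWeakDeriv (cube d B) α f g ∧ ∀ᵐ x ∂volume.restrict (cube d B), |g x| ≤ 1 := by
  obtain ⟨⟨-, hex⟩, hnorm⟩ := hf
  obtain ⟨g, hg, -⟩ := hex α hα
  have h : ∃ g, IsWeakDeriv (cube d B) α f g := ⟨g, hg⟩
  have hw : weakDeriv (cube d B) α f = h.choose := by rw [weakDeriv, dif_pos h]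
  refine ⟨weakDeriv (cube d B) α f, hw ▸ h.choose_spec, ?_⟩
  have h1 : eLpNorm (weakDeriv (cube d B) α f) ∞ (volume.restrict (cube d B)) ≤ 1 :=
    (le_iSup₂ (f := fun (α : Fin d → ℕ) (_ : ∑ i, α i ≤ n) =>
      eLpNorm (weakDeriv (cube d B) α f) ∞ (volume.restrict (cube d B))) α hα).trans hnorm
  rw [eLpNorm_exponent_top] at h1
  filter_upwards [ae_le_eLpNormEssSup (f := weakDeriv (cube d B) α f)
    (μ := volume.restrict (cube d B))] with x hx
  have h2 := hx.trans h1
  rw [← ofReal_norm, ENNReal.ofReal_le_one] at h2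
  exact h2

/-- The zero extension of a function on the cube. -/
noncomputable def cubeExt {d : ℕ} (B : ℝ) (f : (Fin d → ℝ) → ℝ) : (Fin d → ℝ) → ℝ :=
  (cube d B).indicator f

theorem integrable_cubeExt {n d : ℕ} {B : ℝ} {f : (Fin d → ℝ) → ℝ}
    (hf : f ∈ sobolevBall n d B) : Integrable (cubeExt B f) := by
  have hfin : IsFiniteMeasure (volume.restrict (cube d B)) :=
    ⟨by rw [Measure.restrict_apply_univ]; exact (isCompact_cube d B).measure_lt_top⟩
  rw [cubeExt, integrable_indicator_iff (isCompact_cube d B).measurableSet]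
  exact hf.1.1.integrable le_top

/-- Mollification preserves the bounds of the weak derivatives away from the boundary. -/
theorem abs_listDeriv_mollify_le {n d : ℕ} {B : ℝ} (hB : 0 ≤ B) {f : (Fin d → ℝ) → ℝ}
    (hf : f ∈ sobolevBall n d B) (φ : ContDiffBump (0 : Fin d → ℝ)) {l : List (Fin d)}
    (hl : l.length ≤ n) {x : Fin d → ℝ} (hx : ‖x‖ + φ.rOut < B) :
    |listDeriv l (mollify (cubeExt B f) (φ.normed volume)) x| ≤ 1 := by
  set ρ := φ.normed volume with hρdef
  have hρ : ContDiff ℝ ∞ ρ := φ.contDiff_normed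
  have hc : HasCompactSupport ρ := φ.hasCompactSupport_normed
  obtain ⟨g, ⟨-, -, hg⟩, hg1⟩ := exists_isWeakDeriv_of_mem_sobolevBall hf
    (α := fun i => l.count i) (by rw [sum_count_eq_length]; exact hl)
  -- The reflected mollifier is the test function. Its derivatives carry the sign `(-1) ^ l.length`,
  -- which cancels the sign in the definition of the weak derivative.
  set ψ : (Fin d → ℝ) → ℝ := fun t => ρ (x + (-1 : ℝ) • t) with hψdef
  have hψ : ContDiff ℝ ∞ ψ := hρ.comp (contDiff_const.add (contDiff_const_smul _))
  have hψ' : ψ = fun t => ρ (x - t) := by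
    ext t; simp [hψdef, sub_eq_add_neg]
  have hsub : Function.support ψ ⊆ Metric.closedBall x φ.rOut := by
    intro t ht
    rw [hψ'] at ht
    have h1 : x - t ∈ Function.support ρ := ht
    rw [hρdef, φ.support_normed_eq, mem_ball_zero_iff] at h1
    rw [Metric.mem_closedBall, dist_comm, dist_eq_norm]
    exact h1.le
  have hts : tsupport ψ ⊆ Metric.closedBall x φ.rOut :=
    closure_minimal hsub Metric.isClosed_closedBall
  have hcψ : HasCompactSupport ψ := (isCompact_closedBall x φ.rOut).of_isClosed_subset
    (isClosed_tsupport ψ) hts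
  have hint : tsupport ψ ⊆ interior (cube d B) := by
    refine hts.trans fun t ht => ball_subset_interior_cube d hB ?_
    rw [mem_ball_zero_iff]
    rw [Metric.mem_closedBall, dist_eq_norm] at ht
    have := norm_sub_norm_le t x
    linarith
  have key := hg ψ hψ hcψ hint
  rw [multiDeriv_count hψ, listDeriv_comp_affine hρ, sum_count_eq_length] at key
  have h1 : listDeriv l (mollify (cubeExt B f) ρ) x = ∫ t in cube d B, g t * ψ t := by
    rw [listDeriv_mollify (integrable_cubeExt hf).locallyIntegrable hρ hc, mollify_apply]
    have h2 : ∀ t, cubeExt B f t * listDeriv l ρ (x - t) =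
        (cube d B).indicator (fun t => f t * listDeriv l ρ (x - t)) t := by
      intro t
      rw [cubeExt, Set.indicator_mul_left]
    simp only [h2]
    rw [integral_indicator (isCompact_cube d B).measurableSet]
    have h3 : ∀ t, f t * ((-1) ^ l.length * listDeriv l ρ (x + (-1 : ℝ) • t)) =
        (-1) ^ l.length * (f t * listDeriv l ρ (x - t)) := by
      intro t
      rw [neg_one_smul, ← sub_eq_add_neg]
      ring
    simp only [h3] at key
    rw [integral_const_mul] at key
    exact mul_left_cancel₀ (pow_ne_zero _ (by norm_num)) key
  have hψint : Integrable ψ := hψ.continuous.integrable_of_hasCompactSupport hcψ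
  have hψ0 : ∀ t, 0 ≤ ψ t := fun t => φ.nonneg_normed _
  have hψ1 : ∫ t, ψ t = 1 := by
    rw [hψ', integral_sub_left_eq_self (fun t => ρ t)]
    exact φ.integral_normed
  rw [h1, ← Real.norm_eq_abs]
  calc ‖∫ t in cube d B, g t * ψ t‖ ≤ ∫ t in cube d B, ψ t := by
        refine norm_integral_le_of_norm_le hψint.integrableOn ?_
        filter_upwards [hg1] with t ht
        rw [norm_mul, Real.norm_eq_abs, Real.norm_of_nonneg (hψ0 t)]
        exact mul_le_of_le_one_left (hψ0 t) ht
    _ ≤ ∫ t, ψ t := setIntegral_le_integral hψint (Filter.Eventually.of_forall hψ0)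
    _ = 1 := hψ1

/-- This is the Taylor bound of order 1, on a ball of the sup norm that stays `φ.rOut` away from the
boundary. -/
theorem abs_mollify_sub_le {n d : ℕ} (hn : 1 ≤ n) {B : ℝ} (hB : 0 ≤ B) {f : (Fin d → ℝ) → ℝ}
    (hf : f ∈ sobolevBall n d B) (φ : ContDiffBump (0 : Fin d → ℝ)) {x y : Fin d → ℝ}
    (hx : ‖x‖ + φ.rOut < B) (hy : ‖y‖ + φ.rOut < B) :
    |mollify (cubeExt B f) (φ.normed volume) x - mollify (cubeExt B f) (φ.normed volume) y| ≤
      d * ‖x - y‖ := by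
  have h := abs_sub_taylor_le le_rfl (contDiff_mollify (integrable_cubeExt hf).locallyIntegrable
    φ.contDiff_normed φ.hasCompactSupport_normed) (convex_ball (0 : Fin d → ℝ) (B - φ.rOut))
    (fun l hl z hz => abs_listDeriv_mollify_le hB hf φ (hl.trans_le hn)
      (by rw [mem_ball_zero_iff] at hz; linarith))
    (x₀ := y) (x := x) (by rw [mem_ball_zero_iff]; linarith) (by rw [mem_ball_zero_iff]; linarith)
    (h := ‖x - y‖) (fun i => norm_le_pi_norm (x - y) i)
  simpa [listDeriv] using h

theorem ae_norm_ne (d : ℕ) {B : ℝ} (hB : 0 < B) : ∀ᵐ x : Fin d → ℝ, ‖x‖ ≠ B := by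
  have h := Measure.addHaar_sphere_of_ne_zero volume (0 : Fin d → ℝ) hB.ne'
  rw [ae_iff]
  convert h using 2
  ext x
  simp

/-- A function in the Sobolev ball agrees almost everywhere with a Lipschitz function. -/
theorem exists_lipschitz_representative {n d : ℕ} (hn : 1 ≤ n) {B : ℝ} (hB : 0 < B)
    {f : (Fin d → ℝ) → ℝ} (hf : f ∈ sobolevBall n d B) :
    ∃ g : (Fin d → ℝ) → ℝ, LipschitzWith d g ∧ ∀ᵐ x, x ∈ cube d B → f x = g x := by
  let φ : ℕ → ContDiffBump (0 : Fin d → ℝ) := fun k =>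
    ⟨1 / (k + 1 : ℝ) / 2, 1 / (k + 1 : ℝ), by positivity, half_lt_self (by positivity)⟩
  have hφ : Filter.Tendsto (fun k => (φ k).rOut) Filter.atTop (nhds 0) :=
    tendsto_one_div_add_atTop_nhds_zero_nat
  have hae := ContDiffBump.ae_convolution_tendsto_right_of_locallyIntegrable (K := 2) hφ
    (Filter.Eventually.of_forall fun k => by simp only [φ]; linarith)
    (integrable_cubeExt hf).locallyIntegrable
  simp only [← mollify_eq_convolution_swap] at hae
  -- The uniform Lipschitz bound passes to the limit on this set, which has full measure in the
  -- cube; the Lipschitz extension from it is the representative.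
  set E : Set (Fin d → ℝ) := {x | ‖x‖ < B ∧ Filter.Tendsto
    (fun k => mollify (cubeExt B f) ((φ k).normed volume) x) Filter.atTop
      (nhds (cubeExt B f x))} with hE
  have hlip : LipschitzOnWith d (cubeExt B f) E := by
    refine LipschitzOnWith.of_dist_le_mul fun x hx y hy => ?_
    rw [dist_eq_norm, dist_eq_norm]
    refine le_of_tendsto (hx.2.sub hy.2).norm ?_
    have hx' := (hφ.const_add ‖x‖).eventually_lt_const (by simpa using hx.1)
    have hy' := (hφ.const_add ‖y‖).eventually_lt_const (by simpa using hy.1)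
    filter_upwards [hx', hy'] with k hkx hky
    simpa using abs_mollify_sub_le hn hB.le hf (φ k) hkx hky
  obtain ⟨g, hg, heq⟩ := hlip.extend_real
  refine ⟨g, hg, ?_⟩
  filter_upwards [hae, ae_norm_ne d hB] with x hx hne hxc
  have hxE : x ∈ E := ⟨lt_of_le_of_ne ((mem_cube_iff_norm_le hB.le).1 hxc) hne, hx⟩
  rw [← heq hxE, cubeExt, Set.indicator_of_mem hxc]

theorem abs_mollify_sub_representative_le {d : ℕ} {B : ℝ} (hB : 0 ≤ B) {f g : (Fin d → ℝ) → ℝ}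
    (hg : LipschitzWith d g) (hfg : ∀ᵐ x, x ∈ cube d B → f x = g x)
    (φ : ContDiffBump (0 : Fin d → ℝ)) {x : Fin d → ℝ} (hx : ‖x‖ + φ.rOut < B) :
    |mollify (cubeExt B f) (φ.normed volume) x - g x| ≤ d * φ.rOut := by
  have h1 : mollify (cubeExt B f) (φ.normed volume) x = mollify g (φ.normed volume) x := by
    rw [mollify_apply, mollify_apply]
    refine integral_congr_ae ?_
    filter_upwards [hfg] with t ht
    by_cases h0 : φ.normed volume (x - t) = 0
    · simp [h0]
    · have h2 : x - t ∈ Function.support (φ.normed volume) := h0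
      rw [φ.support_normed_eq, mem_ball_zero_iff] at h2
      have htc : t ∈ cube d B := by
        rw [mem_cube_iff_norm_le hB]
        have := norm_sub_norm_le t x
        rw [norm_sub_rev] at this
        linarith
      rw [cubeExt, Set.indicator_of_mem htc, ht htc]
  rw [h1, mollify_eq_convolution_swap, ← Real.dist_eq]
  refine φ.dist_normed_convolution_le hg.continuous.aestronglyMeasurable fun y hy => ?_
  have := hg.dist_le_mul y x
  refine this.trans ?_
  push_cast
  gcongr
  exact (Metric.mem_ball.1 hy).le

/-- The Lipschitz representative is a uniform limit of smooth functions with the same bounds of the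
derivatives on the whole cube. -/
theorem exists_smooth_approx {n d : ℕ} {B : ℝ} (hB : 0 < B)
    {f g : (Fin d → ℝ) → ℝ} (hf : f ∈ sobolevBall n d B) (hg : LipschitzWith d g)
    (hfg : ∀ᵐ x, x ∈ cube d B → f x = g x) {η : ℝ} (hη : 0 < η) :
    ∃ F : (Fin d → ℝ) → ℝ, ContDiff ℝ ∞ F ∧
      (∀ l : List (Fin d), l.length ≤ n → ∀ x ∈ cube d B, |listDeriv l F x| ≤ 1) ∧
      ∀ x ∈ cube d B, |g x - F x| ≤ η := by
  -- Contraction by `1 - θ` leaves a margin `θ * B` for a mollifier of radius `θ * B / 2`;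
  -- contraction and mollification together cost at most `2 * (d + 1) * B * θ`.
  set θ : ℝ := min (1 / 2) (η / (2 * (d + 1) * B))
  have hθ : 0 < θ := by positivity
  have hθ1 : θ ≤ 1 / 2 := min_le_left _ _
  have hθη : 2 * (d + 1) * B * θ ≤ η := by
    have h : θ ≤ η / (2 * (d + 1) * B) := min_le_right _ _
    rw [le_div_iff₀ (by positivity)] at h
    linarith
  have hθB : 0 < θ * B := by positivity
  let φ : ContDiffBump (0 : Fin d → ℝ) :=
    ⟨θ * B / 4, θ * B / 2, by positivity, by linarith⟩
  have hr : φ.rOut = θ * B / 2 := rfl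
  set m := mollify (cubeExt B f) (φ.normed volume)
  have hm : ContDiff ℝ ∞ m := contDiff_mollify (integrable_cubeExt hf).locallyIntegrable
    φ.contDiff_normed φ.hasCompactSupport_normed
  have hin : ∀ x ∈ cube d B, ‖(1 - θ) • x‖ + φ.rOut < B := by
    intro x hx
    rw [mem_cube_iff_norm_le hB.le] at hx
    rw [norm_smul, Real.norm_of_nonneg (by linarith), hr]
    nlinarith
  refine ⟨fun x => m (0 + (1 - θ) • x),
    hm.comp (contDiff_const.add (contDiff_const_smul _)), fun l hl x hx => ?_,
    fun x hx => ?_⟩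
  · rw [listDeriv_comp_affine hm]
    beta_reduce
    rw [zero_add, abs_mul, abs_pow, abs_of_nonneg (by linarith)]
    exact mul_le_one₀ (pow_le_one₀ (by linarith) (by linarith)) (abs_nonneg _)
      (abs_listDeriv_mollify_le hB.le hf φ hl (hin x hx))
  · beta_reduce
    rw [zero_add]
    have h1 := abs_mollify_sub_representative_le hB.le hg hfg φ (hin x hx)
    have h2 := hg.dist_le_mul x ((1 - θ) • x)
    rw [dist_eq_norm, dist_eq_norm, show x - (1 - θ) • x = θ • x by module, norm_smul,
      Real.norm_of_nonneg hθ.le, Real.norm_eq_abs] at h2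
    push_cast at h2
    rw [mem_cube_iff_norm_le hB.le] at hx
    have h3 : d * (θ * ‖x‖) ≤ d * (θ * B) := by gcongr
    rw [abs_sub_comm, hr] at h1
    calc |g x - m ((1 - θ) • x)| ≤ |g x - g ((1 - θ) • x)| + |g ((1 - θ) • x) - m ((1 - θ) • x)| :=
          abs_sub_le _ _ _
      _ ≤ d * (θ * B) + d * (θ * B / 2) := by linarith
      _ ≤ 2 * (d + 1) * B * θ := by nlinarith [(Nat.cast_nonneg d : (0 : ℝ) ≤ d)]
      _ ≤ η := hθη

/-! ### Blended Taylor polynomials as networks -/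

theorem exists_reluSum_eq_affine {d : ℕ} (p : Fin d → ℝ) (c : ℝ) :
    ∃ a b w, ∀ x : Fin d → ℝ, reluSum a b w x = ∑ i, p i * x i + c := by
  refine ⟨![1, -1, 0], ![c, -c, 0], ![p, -p, 0], fun x => ?_⟩
  simp only [reluSum, Fin.sum_univ_three, Matrix.cons_val_zero, Matrix.cons_val_one,
    Matrix.cons_val_two, Matrix.tail_cons, Matrix.head_cons, Pi.neg_apply, neg_mul,
    Finset.sum_neg_distrib, zero_mul, one_mul, add_zero]
  rw [← neg_add, ← sub_eq_add_neg]
  generalize ∑ i, p i * x i + c = y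
  rcases le_total 0 y with hy | hy
  · rw [max_eq_left hy, max_eq_right (neg_nonpos.2 hy), sub_zero]
  · rw [max_eq_right hy, max_eq_left (neg_nonneg.2 hy), zero_sub, neg_neg]

theorem exists_reluSum_eq_hat {d : ℕ} (i : Fin d) (p c : ℝ) :
    ∃ a b w, ∀ x : Fin d → ℝ, reluSum a b w x = hat (p * x i + c) := by
  refine ⟨![1, -2, 1], ![c + 1, c, c - 1], fun _ => Pi.single i p, fun x => ?_⟩
  simp only [reluSum, Fin.sum_univ_three, Matrix.cons_val_zero, Matrix.cons_val_one,
    Matrix.cons_val, Pi.single_apply, ite_mul, zero_mul, Finset.sum_ite_eq', Finset.mem_univ,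
    if_true, hat]
  rw [← add_assoc, ← add_sub_assoc]
  ring

theorem prod_dite_lt {k n : ℕ} (hk : k ≤ n) (q : Fin k → ℝ) :
    ∏ j : Fin n, (if h : j.1 < k then q ⟨j, h⟩ else 1) = ∏ j, q j := by
  obtain ⟨r, rfl⟩ := Nat.exists_eq_add_of_le hk
  rw [Fin.prod_univ_add]
  simp

/-- The index set of the monomials of degree less than `n` in `d` noncommuting variables. -/
abbrev TaylorIndex (n d : ℕ) : Type := Σ k : Fin n, (Fin k → Fin d)

/-- The number of parameters spent on each point of the grid. -/
def blockSize (n d : ℕ) : ℕ :=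
  Fintype.card (TaylorIndex n d) * (Fintype.card ((Fin d ⊕ Fin n) × Fin 3) * (d + 2) +
    Fintype.card (ProdIndex (Fin d ⊕ Fin n)) * (Fintype.card ((Fin d ⊕ Fin n) × Fin 3) + 3))

theorem convex_cube (d : ℕ) (B : ℝ) : Convex ℝ (cube d B) := by
  rw [cube_eq_pi]
  exact convex_pi fun _ _ => convex_Icc _ _

/-- Blending the Taylor polynomials at the points of a grid approximates a smooth function. -/
theorem exists_net_approx_smooth {d n : ℕ} (hn : 1 ≤ n) {B : ℝ} (hB : 0 < B)
    {F : (Fin d → ℝ) → ℝ} (hF : ContDiff ℝ ∞ F)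
    (hb : ∀ l : List (Fin d), l.length ≤ n → ∀ x ∈ cube d B, |listDeriv l F x| ≤ 1)
    {N : ℕ} (hN : 1 ≤ N) {η : ℝ} (hη : 0 < η) :
    ∃ net : SiLUNet 1 d,
      (∀ x ∈ cube d B, |F x - net.eval x 0| ≤ (d * (2 * B / N)) ^ n + η) ∧
      net.size ≤ (N + 1) ^ d * blockSize n d + 2 ∧ net.depth = 3 := by
  have hN0 : (0 : ℝ) < N := by exact_mod_cast hN
  set h : ℝ := 2 * B / N with hh
  have hh0 : 0 < h := by positivity
  have hNh : N * h = 2 * B := by rw [hh]; field_simp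
  let pt : (Fin d → Fin (N + 1)) → Fin d → ℝ := fun m i => -B + h * (m i : ℕ)
  -- The factors of one term: `d` hats, then the linear factors of a monomial, padded with 1 so that
  -- all products have the same index type.
  let U : (Fin d → Fin (N + 1)) × TaylorIndex n d → Fin d ⊕ Fin n → (Fin d → ℝ) → ℝ :=
    fun t k x => Sum.elim (fun i => hat ((x i + B) / h - (t.1 i : ℕ)))
      (fun j : Fin n => if hj : j.1 < t.2.1 then x (t.2.2 ⟨j, hj⟩) - pt t.1 (t.2.2 ⟨j, hj⟩) else 1) k
  have hU : ∀ t k, ∃ a b w, ∀ x : Fin d → ℝ, reluSum a b w x = U t k x := by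
    rintro t (i | j)
    · obtain ⟨a, b, w, H⟩ := exists_reluSum_eq_hat i (1 / h) (B / h - (t.1 i : ℕ))
      refine ⟨a, b, w, fun x => (H x).trans ?_⟩
      simp only [U, Sum.elim_inl]
      congr 1
      ring
    · by_cases hj : j.1 < t.2.1
      · obtain ⟨a, b, w, H⟩ := exists_reluSum_eq_affine
          (Pi.single (t.2.2 ⟨j, hj⟩) 1) (-pt t.1 (t.2.2 ⟨j, hj⟩))
        refine ⟨a, b, w, fun x => (H x).trans ?_⟩
        simp only [U, Sum.elim_inr]
        rw [dif_pos hj]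
        simp [Pi.single_apply, sub_eq_add_neg]
      · obtain ⟨a, b, w, H⟩ := exists_reluSum_eq_affine (0 : Fin d → ℝ) 1
        refine ⟨a, b, w, fun x => (H x).trans ?_⟩
        simp only [U, Sum.elim_inr]
        rw [dif_neg hj]
        simp
  choose a b w hrelu using hU
  let c : (Fin d → Fin (N + 1)) × TaylorIndex n d → ℝ := fun t =>
    (t.2.1.1.factorial : ℝ)⁻¹ * listDeriv (List.ofFn t.2.2) F (pt t.1)
  obtain ⟨net, hnet, hsize, hdepth⟩ :=
    exists_net_approx_sum_prod_reluSum (Fin d ⊕ Fin n) B c a b w hη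
  refine ⟨net, fun x hx => ?_, ?_, hdepth⟩
  · let P : (Fin d → Fin (N + 1)) → ℝ := fun m =>
      ∑ k ∈ Finset.range n, (k.factorial : ℝ)⁻¹ * ∑ i : Fin k → Fin d,
        (∏ j, (x (i j) - pt m (i j))) * listDeriv (List.ofFn i) F (pt m)
    let H : (Fin d → Fin (N + 1)) → ℝ := fun m => ∏ i, hat ((x i + B) / h - (m i : ℕ))
    have hsum : ∑ t, c t * ∏ k, reluSum (a t k) (b t k) (w t k) x = ∑ m, H m * P m := by
      simp only [hrelu]
      rw [Fintype.sum_prod_type]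
      refine Finset.sum_congr rfl fun m _ => ?_
      rw [Fintype.sum_sigma]
      simp only [P]
      rw [Finset.sum_range, Finset.mul_sum]
      refine Finset.sum_congr rfl fun k _ => ?_
      rw [Finset.mul_sum, Finset.mul_sum]
      refine Finset.sum_congr rfl fun i _ => ?_
      rw [Fintype.prod_sum_type]
      simp only [U, Sum.elim_inl, Sum.elim_inr, c]
      rw [prod_dite_lt k.2.le fun j => x (i j) - pt m (i j)]
      simp only [H]
      ring
    have hH0 : ∀ m, 0 ≤ H m := fun m => Finset.prod_nonneg fun i _ => hat_nonneg _
    have hH1 : ∑ m, H m = 1 := by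
      refine sum_prod_hat_eq_one fun i => ?_
      have := hx i
      refine ⟨div_nonneg (by linarith [this.1]) hh0.le, ?_⟩
      rw [div_le_iff₀ hh0, hNh]
      linarith [this.2]
    have hloc : ∀ m, |H m * (F x - P m)| ≤ H m * (d * h) ^ n := by
      intro m
      rw [abs_mul, abs_of_nonneg (hH0 m)]
      rcases eq_or_ne (H m) 0 with h0 | h0
      · simp [h0]
      refine mul_le_mul_of_nonneg_left ?_ (hH0 m)
      refine abs_sub_taylor_le hn hF (convex_cube d B) (fun l hl => hb l hl.le) (fun i => ?_) hx
        fun i => ?_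
      · have hm : ((m i : ℕ) : ℝ) ≤ N := by exact_mod_cast Nat.lt_succ_iff.1 (m i).2
        have h1 : h * (m i : ℕ) ≤ 2 * B := by rw [← hNh]; nlinarith
        have h2 : 0 ≤ h * (m i : ℕ) := by positivity
        exact ⟨by simp only [pt]; linarith, by simp only [pt]; linarith⟩
      · have h1 := abs_le_one_of_hat_ne_zero (Finset.prod_ne_zero_iff.1 h0 i (Finset.mem_univ i))
        have h2 : x i - pt m i = h * ((x i + B) / h - (m i : ℕ)) := by
          simp only [pt]
          field_simp
          ring
        rw [h2, abs_mul, abs_of_pos hh0]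
        exact mul_le_of_le_one_right hh0.le h1
    have hblend : |F x - ∑ m, H m * P m| ≤ (d * h) ^ n := by
      have h1 : F x - ∑ m, H m * P m = ∑ m, H m * (F x - P m) := by
        simp only [mul_sub, Finset.sum_sub_distrib]
        rw [← Finset.sum_mul, hH1, one_mul]
      rw [h1]
      refine (Finset.abs_sum_le_sum_abs _ _).trans ((Finset.sum_le_sum fun m _ => hloc m).trans ?_)
      rw [← Finset.sum_mul, hH1, one_mul]
    have h1 := hnet x hx
    rw [hsum] at h1
    exact (abs_sub_le _ _ _).trans (add_le_add hblend h1)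
  · refine hsize.trans (le_of_eq ?_)
    rw [blockSize, Fintype.card_prod (Fin d → Fin (N + 1)), Fintype.card_fun, Fintype.card_fin,
      Fintype.card_fin, mul_assoc]

/-! ### Choice of the grid and count of the parameters -/

theorem theorem8 (d n : ℕ) (hd : 1 ≤ d) (hn : 1 ≤ n) (B : ℝ) (hB0 : 0 < B) (hB1 : B ≤ 1) :
    ∃ (L : ℕ) (C : ℝ), 0 < C ∧
      ∀ f ∈ sobolevBall n d B,
        -- the continuous representative of `f`, through which its pointwise values are understood
        ∃ g : (Fin d → ℝ) → ℝ, ContinuousOn g (cube d B) ∧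
          f =ᵐ[MeasureTheory.volume.restrict (cube d B)] g ∧
          ∀ ε : ℝ, 0 < ε → ε < 1 →
            ∃ N : SiLUNet 1 d,
              (∀ x ∈ cube d B, |g x - N.eval x 0| ≤ ε) ∧
              (N.size : ℝ) ≤ C * ε ^ (-(d : ℝ) / (n : ℝ)) ∧
              N.depth = L := by
  -- With `r = ε ^ (-1 / n) ≥ 1`, `N + 1 ≤ 6 * d * r + 2 ≤ (6 * d + 2) * r`, and the additive 2 is
  -- at most `2 * r ^ d`.
  refine ⟨3, (6 * d + 2) ^ d * blockSize n d + 2, by positivity, fun f hf => ?_⟩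
  obtain ⟨g, hg, hfg⟩ := exists_lipschitz_representative hn hB0 hf
  refine ⟨g, hg.continuous.continuousOn,
    (ae_restrict_iff' (isCompact_cube d B).measurableSet).2 hfg, fun ε hε hε1 => ?_⟩
  have hε3 : 0 < ε / 3 := by positivity
  obtain ⟨F, hF, hFb, hgF⟩ := exists_smooth_approx hB0 hf hg hfg hε3
  have hn0 : (n : ℝ) ≠ 0 := by positivity
  have hd1 : (1 : ℝ) ≤ d := by exact_mod_cast hd
  set r : ℝ := ε ^ (-1 / (n : ℝ)) with hr
  have hr1 : 1 ≤ r := Real.one_le_rpow_of_pos_of_le_one_of_nonpos hε hε1.le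
    (div_nonpos_of_nonpos_of_nonneg (by norm_num) (Nat.cast_nonneg n))
  have hrn : r ^ n = ε⁻¹ := by
    rw [hr, ← Real.rpow_natCast, ← Real.rpow_mul hε.le, div_mul_cancel₀ _ hn0, Real.rpow_neg_one]
  have hrd : r ^ d = ε ^ (-(d : ℝ) / (n : ℝ)) := by
    rw [hr, ← Real.rpow_natCast, ← Real.rpow_mul hε.le]
    congr 1
    ring
  -- As `B ≤ 1`, this gives `d * (2 * B / N) ≤ 1 / (3 * r)`, whose `n`-th power is at most `ε / 3`.
  -- Smoothing and the network take the other two thirds.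
  set N : ℕ := ⌈6 * d * r⌉₊
  have hN : 6 * d * r ≤ N := Nat.le_ceil _
  have hN' : (N : ℝ) < 6 * d * r + 1 := Nat.ceil_lt_add_one (by positivity)
  have hNpos : (0 : ℝ) < N := lt_of_lt_of_le (by positivity) hN
  obtain ⟨net, hnet, hsize, hdepth⟩ := exists_net_approx_smooth hn hB0 hF hFb
    (N := N) (by exact_mod_cast hNpos) hε3
  refine ⟨net, fun x hx => ?_, ?_, hdepth⟩
  · have h1 : d * (2 * B / N) ≤ 1 / (3 * r) := by
      rw [mul_div_assoc', div_le_div_iff₀ hNpos (by positivity)]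
      have : d * r * B ≤ d * r := mul_le_of_le_one_right (by positivity) hB1
      nlinarith
    have h2 : (d * (2 * B / N)) ^ n ≤ ε / 3 := by
      refine (pow_le_pow_left₀ (by positivity) h1 n).trans ?_
      rw [div_pow, one_pow, mul_pow, hrn, one_div, mul_inv, inv_inv, mul_comm, ← div_eq_mul_inv]
      gcongr
      exact le_self_pow₀ (by norm_num) (by omega)
    have h3 := abs_sub_le (g x) (F x) (net.eval x 0)
    linarith [hgF x hx, hnet x hx]
  · have h1 : (net.size : ℝ) ≤ ((N : ℝ) + 1) ^ d * blockSize n d + 2 := by exact_mod_cast hsize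
    have h2 : ((N : ℝ) + 1) ^ d ≤ (6 * d + 2) ^ d * r ^ d := by
      rw [← mul_pow]
      refine pow_le_pow_left₀ (by positivity) ?_ d
      linarith
    rw [← hrd]
    calc (net.size : ℝ) ≤ ((N : ℝ) + 1) ^ d * blockSize n d + 2 := h1
      _ ≤ (6 * d + 2) ^ d * r ^ d * blockSize n d + 2 * r ^ d := by
        gcongr
        linarith [one_le_pow₀ (n := d) hr1]
      _ = ((6 * d + 2) ^ d * blockSize n d + 2) * r ^ d := by ring
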